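/- A Dyck path of length $2n$ is a word of $n$ letters $U$ and $n$ letters $D$ in which every prefix has at least as many $U$'s as $D$'s; a $k$-ascent of it is a maximal run of exactly $k\ge 1$ consecutive $U$'s. Let $m\ge 1$ and $n\ge 0$ be integers, and let $\mathcal{M}^m(k)$ be the set of Dyck paths of length $2k$ all of whose ascents have length at most $m$. Let $\mathcal{D}^{\mathfrak{M}^m}(n)$ be the set of Dyck paths of length $2n$ together with, for every $k\ge 1$, an assignment to each $k$-ascent of a colour from $\mathcal{M}^m(k)$. Fix a convex $2n$-gon with vertices labelled in clockwise order (for $n=1$: two distinct points; for $n=0$: no points), and let $\mathcal{E}^m(n)$ be the set of partitions of its vertices into blocks of even size at most $2m$ with pairwise disjoint convex hulls. Then both sets are finite and there is a bijection between $\mathcal{D}^{\mathfrak{M}^m}(n)$ and $\mathcal{E}^m(n)$. If moreover $n\ge 1$, then both sets have cardinality $$\sum_{\substack{p\ge 0\\ mp<n}}\frac{(-1)^p}{n-mp}\binom{n-mp}{p}\binom{3n-mp-p}{n-mp-1}.$$ -/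

import Mathlib

/-- The lengths of the ascents (maximal runs of consecutive `U`'s) of a Dyck path, from left to
right: the letters `D` cut the path into runs of `U`'s, and the empty runs are discarded. -/
def DyckWord.ascentLengths (P : DyckWord) : List ℕ :=
  ((P.toList.splitOn DyckStep.D).map List.length).filter (fun k => k ≠ 0)

/-- The Dyck paths of length `2 * k` all of whose ascents have length at most `m`. -/
def boundedDyck (m k : ℕ) : Set DyckWord :=
  {P | P.semilength = k ∧ ∀ a ∈ P.ascentLengths, a ≤ m}

/-- The Dyck paths of length `2 * n` with ascents coloured by the sequence of sets `L`: pairs of a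
Dyck path `P` of length `2 * n` and the list of the colours of its ascents, from left to right,
where the colour of each ascent of length `k` is an element of `L k`. -/
def colouredDyck {α : Type*} (L : ℕ → Set α) (n : ℕ) : Set (DyckWord × List α) :=
  {x | x.1.semilength = n ∧ List.Forall₂ (fun k c => c ∈ L k) x.1.ascentLengths x.2}

/-- `v 0, v 1, …, v (N - 1)` are the vertices of a convex `N`-gon in the plane, listed in clockwise
order: they are distinct, and any three of them, taken in the order of their labels, form a
non-degenerate triangle traversed clockwise. (Distinctness matters only for the `2`-gon.) -/
def IsConvexPolygon {N : ℕ} (v : Fin N → EuclideanSpace ℝ (Fin 2)) : Prop :=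
  Function.Injective v ∧
    ∀ i j k : Fin N, i < j → j < k →
      (v j 0 - v i 0) * (v k 1 - v i 1) - (v j 1 - v i 1) * (v k 0 - v i 0) < 0

/-- The partitions of the vertices `v i` of an `N`-gon (written as partitions of the set of labels)
into blocks of even size at most `2 * m` with pairwise disjoint convex hulls. -/
def evenHullPartitions (m : ℕ) {N : ℕ} (v : Fin N → EuclideanSpace ℝ (Fin 2)) :
    Set (Finpartition (Finset.univ : Finset (Fin N))) :=
  {π | (∀ B ∈ π.parts, Even B.card ∧ B.card ≤ 2 * m) ∧
    ∀ B ∈ π.parts, ∀ C ∈ π.parts, B ≠ C →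
      Disjoint (convexHull ℝ (v '' (B : Set (Fin N)))) (convexHull ℝ (v '' (C : Set (Fin N))))}

/-! Both sets have cardinality `1/(2n+1) · [x^n] C^(2n+1)` with `C = 1 + x + ... + x^m`. The
bijection is not explicit: it comes from equality of finite cardinalities. Both sides are reduced to
weighted Łukasiewicz words, counted by the cycle lemma `lukSum_mul_length`.

Dyck side: the lengths of the runs of `U` between consecutive `D`'s form a word of length `n+1` from
height 1. Its letter `k` is weighted by the number of colours, itself the number of words of length
`k+1` with letters at most `m`. The cycle lemma gives `[x^n] G^(n+1)` with `G` the series of these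
weights; by `coeff_mk_lukSum_pow` this counts words of length `2n+1` from height `n+1`, and a second
use of the cycle lemma gives `C`.

Polygon side: disjoint hulls mean that blocks do not cross. A noncrossing partition is determined by
its block sizes written at the block minima, with 0 elsewhere (`fiberCard_injOn`,
`IsLukFun.exists_isNoncrossing`). A final 0 makes this a word of length `2n+1` from height 1 with
even letters at most `2m`, so the cycle lemma yields `[x^(2n)] C(x^2)^(2n+1)`.

The explicit sum is the expansion of `((1 - x^(m+1))/(1 - x))^(2n+1)`. -/

/-! ### Łukasiewicz words and the cycle lemma -/

/-- A Łukasiewicz word from height `h`: each letter `a` changes the height by `a - 1`, the height is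
positive before every letter and zero at the end. -/
def IsLuk : ℕ → List ℕ → Prop
  | h, [] => h = 0
  | 0, _ :: _ => False
  | h + 1, a :: l => IsLuk (h + a) l

/-- A letter lowers the height by at most one. This bounds the letters and so makes the enumeration
`lukWords` finite. -/
theorem IsLuk.le_length : ∀ {l : List ℕ} {h : ℕ}, IsLuk h l → h ≤ l.length
  | [], h, hl => by simpa [IsLuk] using hl
  | _ :: _, 0, hl => by simp
  | a :: l, h + 1, hl => by
    have := IsLuk.le_length (l := l) (h := h + a) hl
    simp only [List.length_cons]
    omega

/-- The Łukasiewicz words of length `ℓ` from height `h`. -/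
def lukWords : ℕ → ℕ → Finset (List ℕ)
  | 0, 0 => {[]}
  | 0, _ + 1 => ∅
  | _ + 1, 0 => ∅
  | ℓ + 1, h + 1 => (Finset.range (ℓ + 1)).biUnion fun k =>
      (lukWords ℓ (h + k)).map ⟨List.cons k, List.cons_injective⟩

theorem mem_lukWords : ∀ {ℓ h : ℕ} {l : List ℕ}, l ∈ lukWords ℓ h ↔ l.length = ℓ ∧ IsLuk h l
  | 0, 0, l => by cases l <;> simp [lukWords, IsLuk]
  | 0, _ + 1, l => by cases l <;> simp [lukWords, IsLuk]
  | ℓ + 1, 0, l => by cases l <;> simp [lukWords, IsLuk]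
  | ℓ + 1, h + 1, l => by
    cases l with
    | nil => simp [lukWords]
    | cons a l =>
      have ih := fun k => @mem_lukWords ℓ (h + k) l
      simp only [lukWords, Finset.mem_biUnion, Finset.mem_range, Finset.mem_map,
        Function.Embedding.coeFn_mk, List.cons.injEq, List.length_cons, Nat.add_right_cancel_iff,
        IsLuk]
      constructor
      · rintro ⟨k, -, l', hl', rfl, rfl⟩
        exact (ih _).1 hl'
      · intro hl
        have := hl.2.le_length
        exact ⟨a, by omega, l, (ih _).2 hl, rfl, rfl⟩

/-- The weighted number of Łukasiewicz words, the letter `k` having weight `c k`. -/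
def lukSum (c : ℕ → ℚ) (ℓ h : ℕ) : ℚ := ∑ l ∈ lukWords ℓ h, (l.map c).prod

section lukSum

variable (c : ℕ → ℚ)

@[simp] theorem lukSum_zero_zero : lukSum c 0 0 = 1 := by simp [lukSum, lukWords]

@[simp] theorem lukSum_succ_zero (ℓ : ℕ) : lukSum c (ℓ + 1) 0 = 0 := by simp [lukSum, lukWords]

theorem lukSum_of_lt {ℓ h : ℕ} (hl : ℓ < h) : lukSum c ℓ h = 0 := by
  refine Finset.sum_eq_zero fun l hmem => ?_
  rw [mem_lukWords] at hmem
  have := hmem.2.le_length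
  omega

theorem lukSum_succ_succ (ℓ h : ℕ) :
    lukSum c (ℓ + 1) (h + 1) = ∑ k ∈ Finset.range (ℓ + 1), c k * lukSum c ℓ (h + k) := by
  rw [lukSum, lukWords, Finset.sum_biUnion]
  · simp [lukSum, Finset.mul_sum]
  · intro i _ j _ hij
    simp only [Function.onFun, Finset.disjoint_left, Finset.mem_map, Function.Embedding.coeFn_mk,
      not_exists, not_and]
    rintro _ ⟨l, -, rfl⟩ l' - h'
    exact hij (List.cons.inj h').1.symm

open PowerSeries in
/-- The cycle lemma for weighted Łukasiewicz words. -/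
theorem lukSum_mul_length (ℓ : ℕ) : ∀ h d : ℕ, h + d = ℓ →
    (ℓ : ℚ) * lukSum c ℓ h = h * coeff d (PowerSeries.mk c ^ ℓ) := by
  induction ℓ with
  | zero => intro h d hd; obtain ⟨rfl, rfl⟩ : h = 0 ∧ d = 0 := by omega
            simp
  | succ ℓ ih =>
    intro h d hd
    obtain _ | h := h
    · simp
    have hd' : h + d = ℓ := by omega
    obtain rfl | hℓ := Nat.eq_zero_or_pos ℓ
    · obtain ⟨rfl, rfl⟩ : h = 0 ∧ d = 0 := by omega
      simp [lukSum_succ_succ]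
    have hℓ0 : (ℓ : ℚ) ≠ 0 := by positivity
    set C := PowerSeries.mk c with hC
    -- Remove the first letter `k`. The induction hypothesis brings a factor `h + k`: its part `h`
    -- convolves to `C * C ^ ℓ`, its part `k` to `X * C' * C ^ ℓ`.
    have key : (ℓ : ℚ) * lukSum c (ℓ + 1) (h + 1) =
        h * coeff d (C * C ^ ℓ) + coeff d (X * derivative ℚ C * C ^ ℓ) := by
      rw [lukSum_succ_succ, Finset.mul_sum, coeff_mul, coeff_mul,
        Finset.Nat.sum_antidiagonal_eq_sum_range_succ_mk,
        Finset.Nat.sum_antidiagonal_eq_sum_range_succ_mk, Finset.mul_sum, ← Finset.sum_add_distrib]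
      rw [← Finset.sum_subset (Finset.range_mono (show d + 1 ≤ ℓ + 1 by omega))]
      · refine Finset.sum_congr rfl fun k hk => ?_
        have hk : k ≤ d := by simpa [Nat.lt_succ_iff] using hk
        have := ih (h + k) (d - k) (by omega)
        have h1 : coeff k (X * derivative ℚ C) = k * c k := by
          cases k with
          | zero => simp
          | succ k =>
            rw [coeff_succ_X_mul, coeff_derivative]
            simp [hC, mul_comm]
        rw [h1, mul_left_comm, this]
        simp only [hC, coeff_mk]
        push_cast
        ring
      · intro k _ hk
        rw [Finset.mem_range, not_lt] at hk
        rw [lukSum_of_lt c (by omega)]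
        simp
    have hder : ((ℓ : ℚ) + 1) * coeff d (X * derivative ℚ C * C ^ ℓ) = d * coeff d (C ^ (ℓ + 1)) := by
      have e : derivative ℚ (C ^ (ℓ + 1)) = (PowerSeries.C ((ℓ : ℚ) + 1)) * (derivative ℚ C * C ^ ℓ) := by
        rw [Derivation.leibniz_pow]
        simp only [Nat.add_sub_cancel, smul_eq_mul, nsmul_eq_mul]
        simp only [map_add, map_natCast, map_one]
        push_cast
        ring
      have e2 : coeff d (X * derivative ℚ (C ^ (ℓ + 1))) = d * coeff d (C ^ (ℓ + 1)) := by
        cases d with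
        | zero => simp
        | succ k =>
          rw [coeff_succ_X_mul, coeff_derivative]
          push_cast; ring
      rw [← e2, e, mul_left_comm, coeff_C_mul, mul_assoc]
    have hdℓ : (h : ℚ) + d = ℓ := by exact_mod_cast hd'
    apply mul_left_cancel₀ hℓ0
    rw [← pow_succ'] at key
    have : (ℓ : ℚ) * (((ℓ + 1 : ℕ) : ℚ) * lukSum c (ℓ + 1) (h + 1)) =
      (ℓ + 1) * ((ℓ : ℚ) * lukSum c (ℓ + 1) (h + 1)) := by push_cast; ring
    -- The factors combine by `(ℓ + 1) h + d = ℓ (h + 1)`, as `h + d = ℓ`.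
    rw [this, key, mul_add, hder, ← hdℓ]
    push_cast
    ring

/-- A word from height `h + g` splits uniquely where it first reaches height `g`. The induction
peels off first letters instead of locating this cut. -/
theorem lukSum_add (ℓ : ℕ) : ∀ h g : ℕ,
    ∑ x ∈ Finset.HasAntidiagonal.antidiagonal ℓ, lukSum c x.1 h * lukSum c x.2 g = lukSum c ℓ (h + g) := by
  induction ℓ with
  | zero =>
    rintro (_ | h) g
    · simp
    · simp [lukSum_of_lt]
  | succ ℓ ih =>
    rintro (_ | h) g
    · rw [Finset.Nat.sum_antidiagonal_succ]
      simp
    rw [Finset.Nat.sum_antidiagonal_succ, lukSum_of_lt c (Nat.succ_pos h), zero_mul, zero_add,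
      show h + 1 + g = h + g + 1 by omega, lukSum_succ_succ]
    have : ∀ x ∈ Finset.HasAntidiagonal.antidiagonal ℓ, lukSum c (x.1 + 1) (h + 1) * lukSum c x.2 g =
        ∑ k ∈ Finset.range (ℓ + 1), c k * (lukSum c x.1 (h + k) * lukSum c x.2 g) := by
      intro x hx
      rw [Finset.HasAntidiagonal.mem_antidiagonal] at hx
      rw [lukSum_succ_succ, Finset.sum_mul,
        ← Finset.sum_subset (Finset.range_mono (show x.1 + 1 ≤ ℓ + 1 by omega))]
      · exact Finset.sum_congr rfl fun k _ => by ring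
      · intro k _ hk
        rw [Finset.mem_range, not_lt] at hk
        rw [lukSum_of_lt c (by omega)]
        simp
    rw [Finset.sum_congr rfl this, Finset.sum_comm]
    refine Finset.sum_congr rfl fun k _ => ?_
    rw [← Finset.mul_sum, ih, show h + k + g = h + g + k by omega]

open PowerSeries in
/-- The `r`-th power of the generating series of the words from height `1` counts the words from
height `r`. -/
theorem coeff_mk_lukSum_pow (r n : ℕ) :
    coeff n (PowerSeries.mk (fun k => lukSum c (k + 1) 1) ^ r) = lukSum c (n + r) r := by
  have hX : X * PowerSeries.mk (fun k => lukSum c (k + 1) 1) =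
      PowerSeries.mk (fun k => lukSum c k 1) := by
    ext (_ | n)
    · simp [lukSum_of_lt]
    · simp [coeff_succ_X_mul]
  have hp : ∀ r n, coeff n (PowerSeries.mk (fun k => lukSum c k 1) ^ r) = lukSum c n r := by
    intro r
    induction r with
    | zero => rintro (_ | n) <;> simp [coeff_one]
    | succ r ih =>
      intro n
      rw [pow_succ, coeff_mul, ← lukSum_add]
      simp [ih]
  rw [← hp, ← hX, mul_pow, coeff_X_pow_mul]

end lukSum

/-! ### Dyck paths as Łukasiewicz words -/

/-- The lengths of the (possibly empty) runs of `U` cut out by the letters `D`. -/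
def runLengths (L : List DyckStep) : List ℕ := (L.splitOn DyckStep.D).map List.length

theorem runLengths_nil : runLengths [] = [0] := by simp [runLengths]

theorem runLengths_cons_D (L : List DyckStep) :
    runLengths (DyckStep.D :: L) = 0 :: runLengths L := by
  simp [runLengths, List.splitOn, List.splitOnP_cons_eq_if_modifyHead]

theorem runLengths_cons_U (L : List DyckStep) :
    runLengths (DyckStep.U :: L) = (runLengths L).modifyHead (· + 1) := by
  simp only [runLengths, List.splitOn, List.splitOnP_cons_eq_if_modifyHead]
  cases List.splitOnP (fun x => x == DyckStep.D) L <;> simp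

theorem runLengths_ne_nil (L : List DyckStep) : runLengths L ≠ [] := by
  simp [runLengths, List.splitOn]

theorem length_runLengths : ∀ L : List DyckStep,
    (runLengths L).length = L.count DyckStep.D + 1
  | [] => by simp [runLengths_nil]
  | DyckStep.D :: L => by simp [runLengths_cons_D, length_runLengths L]
  | DyckStep.U :: L => by simp [runLengths_cons_U, length_runLengths L]

theorem runLengths_injective : Function.Injective runLengths := by
  intro L
  induction L with
  | nil =>
    rintro (_ | ⟨_ | _, L'⟩) h
    · rfl
    · obtain ⟨k, t, e⟩ := List.exists_cons_of_ne_nil (runLengths_ne_nil L')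
      simp [runLengths_nil, runLengths_cons_U, e] at h
    · simp [runLengths_nil, runLengths_cons_D, runLengths_ne_nil] at h
  | cons a L ih =>
    obtain ⟨k, t, e⟩ := List.exists_cons_of_ne_nil (runLengths_ne_nil L)
    rintro (_ | ⟨b, L'⟩) h
    · cases a <;> simp [runLengths_nil, runLengths_cons_U, runLengths_cons_D, e] at h
    · obtain ⟨k', t', e'⟩ := List.exists_cons_of_ne_nil (runLengths_ne_nil L')
      have ih' := @ih L'
      cases a <;> cases b <;>
        simp_all [runLengths_cons_U, runLengths_cons_D]

theorem exists_runLengths_eq : ∀ l : List ℕ, l ≠ [] → ∃ L, runLengths L = l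
  | [], h => absurd rfl h
  | [0], _ => ⟨[], runLengths_nil⟩
  | 0 :: a :: l, _ => by
    obtain ⟨L, hL⟩ := exists_runLengths_eq (a :: l) (by simp)
    exact ⟨DyckStep.D :: L, by rw [runLengths_cons_D, hL]⟩
  | (k + 1) :: l, _ => by
    obtain ⟨L, hL⟩ := exists_runLengths_eq (k :: l) (by simp)
    exact ⟨DyckStep.U :: L, by rw [runLengths_cons_U, hL]; rfl⟩

/-- A letter is a run of `U`'s together with the `D` that closes it. The last run has no such `D`;
starting one unit higher pays for a fictitious one. -/
theorem isLuk_runLengths : ∀ (L : List DyckStep) (h : ℕ), IsLuk (h + 1) (runLengths L) ↔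
    L.count DyckStep.D = h + L.count DyckStep.U ∧
      ∀ i, (L.take i).count DyckStep.D ≤ h + (L.take i).count DyckStep.U
  | [], h => by simp [runLengths_nil, IsLuk, eq_comm]
  | DyckStep.D :: L, 0 => by
    obtain ⟨k, t, e⟩ := List.exists_cons_of_ne_nil (runLengths_ne_nil L)
    simp only [runLengths_cons_D, IsLuk, e, false_iff, not_and, not_forall]
    intro _
    exact ⟨1, by simp⟩
  | DyckStep.D :: L, h + 1 => by
    rw [runLengths_cons_D, IsLuk, add_zero, isLuk_runLengths L h]
    simp only [List.count_cons_self]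
    rw [List.count_cons_of_ne (by simp)]
    refine and_congr (by omega) ⟨fun H i => ?_, fun H i => ?_⟩
    · cases i with
      | zero => simp
      | succ i =>
        have := H i
        simp only [List.take_succ_cons, List.count_cons_self]
        rw [List.count_cons_of_ne (by simp)]
        omega
    · have := H (i + 1)
      simp only [List.take_succ_cons, List.count_cons_self] at this
      rw [List.count_cons_of_ne (by simp)] at this
      omega
  | DyckStep.U :: L, h => by
    obtain ⟨k, t, e⟩ := List.exists_cons_of_ne_nil (runLengths_ne_nil L)
    have ih := isLuk_runLengths L (h + 1)
    rw [e, IsLuk, add_right_comm] at ih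
    rw [runLengths_cons_U, e, List.modifyHead_cons, IsLuk, ← add_assoc, ih]
    simp only [List.count_cons_self]
    rw [List.count_cons_of_ne (by simp)]
    refine and_congr (by omega) ⟨fun H i => ?_, fun H i => ?_⟩
    · cases i with
      | zero => simp
      | succ i =>
        have := H i
        simp only [List.take_succ_cons, List.count_cons_self]
        rw [List.count_cons_of_ne (by simp)]
        omega
    · have := H (i + 1)
      simp only [List.take_succ_cons, List.count_cons_self] at this
      rw [List.count_cons_of_ne (by simp)] at this
      omega

namespace DyckWord

theorem ascentLengths_eq (P : DyckWord) :
    P.ascentLengths = (runLengths P.toList).filter (fun k => k ≠ 0) := rfl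

theorem runLengths_toList_injective : Function.Injective fun P : DyckWord => runLengths P.toList :=
  fun _ _ h => DyckWord.ext (runLengths_injective h)

theorem runLengths_toList_mem_lukWords (P : DyckWord) :
    runLengths P.toList ∈ lukWords (P.semilength + 1) 1 := by
  rw [mem_lukWords, length_runLengths, isLuk_runLengths _ 0]
  have := P.count_U_eq_count_D
  refine ⟨by rw [semilength, this], by omega, fun i => ?_⟩
  have := P.count_D_le_count_U i
  omega

theorem exists_runLengths_toList_eq {n : ℕ} {l : List ℕ} (hl : l ∈ lukWords (n + 1) 1) :
    ∃ P : DyckWord, P.semilength = n ∧ runLengths P.toList = l := by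
  rw [mem_lukWords] at hl
  obtain ⟨L, rfl⟩ := exists_runLengths_eq l (by rintro rfl; simp at hl)
  rw [length_runLengths, isLuk_runLengths _ 0] at hl
  obtain ⟨h1, h2, h3⟩ := hl
  refine ⟨⟨L, by omega, fun i => by have := h3 i; omega⟩, ?_, rfl⟩
  rw [semilength]
  simp only
  omega

end DyckWord

theorem image_boundedDyck (m k : ℕ) :
    (fun P : DyckWord => runLengths P.toList) '' boundedDyck m k =
      ((lukWords (k + 1) 1).filter fun l => ∀ a ∈ l, a ≤ m : Finset (List ℕ)) := by
  ext l
  simp only [Set.mem_image, boundedDyck, Set.mem_ofPred_eq, Finset.coe_filter]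
  constructor
  · rintro ⟨P, ⟨rfl, hP⟩, rfl⟩
    refine ⟨P.runLengths_toList_mem_lukWords, fun a ha => ?_⟩
    by_cases h0 : a = 0
    · omega
    · exact hP a (by rw [P.ascentLengths_eq]; simpa using ⟨ha, h0⟩)
  · rintro ⟨hl, hm⟩
    obtain ⟨P, hP, rfl⟩ := DyckWord.exists_runLengths_toList_eq hl
    exact ⟨P, ⟨hP, fun a ha => hm a (List.mem_of_mem_filter ha)⟩, rfl⟩

theorem finite_boundedDyck (m k : ℕ) : (boundedDyck m k).Finite := by
  refine Set.Finite.of_finite_image ?_ DyckWord.runLengths_toList_injective.injOn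
  rw [image_boundedDyck]
  exact Finset.finite_toSet _

theorem prod_map_ite (p : ℕ → Prop) [DecidablePred p] (l : List ℕ) :
    (l.map fun a => if p a then (1 : ℚ) else 0).prod = if ∀ a ∈ l, p a then 1 else 0 := by
  induction l with
  | nil => simp
  | cons a l ih => simp only [List.map_cons, List.prod_cons, ih, List.forall_mem_cons]
                   by_cases h : p a <;> simp [h]

theorem card_filter_lukWords (p : ℕ → Prop) [DecidablePred p] (ℓ h : ℕ) :
    (((lukWords ℓ h).filter fun l => ∀ a ∈ l, p a).card : ℚ) =
      lukSum (fun a => if p a then 1 else 0) ℓ h := by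
  simp [lukSum, prod_map_ite]

theorem ncard_boundedDyck (m k : ℕ) :
    ((boundedDyck m k).ncard : ℚ) = lukSum (fun a => if a ≤ m then 1 else 0) (k + 1) 1 := by
  rw [← Set.ncard_image_of_injective _ DyckWord.runLengths_toList_injective, image_boundedDyck,
    Set.ncard_coe_finset, card_filter_lukWords]

/-! ### Counting coloured Dyck paths -/

/-- The lists with entries chosen from the sets `F k`, where `k` runs through the given list. -/
def choiceLists {α : Type*} (F : ℕ → Finset α) : List ℕ → Finset (List α)
  | [] => {[]}
  | k :: l => (F k ×ˢ choiceLists F l).map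
      ⟨fun x => x.1 :: x.2, fun _ _ h => Prod.ext (List.cons.inj h).1 (List.cons.inj h).2⟩

theorem mem_choiceLists {α : Type*} {F : ℕ → Finset α} : ∀ {l : List ℕ} {cs : List α},
    cs ∈ choiceLists F l ↔ List.Forall₂ (fun k c => c ∈ F k) l cs
  | [], cs => by simp [choiceLists]
  | k :: l, [] => by simp [choiceLists]
  | k :: l, c :: cs => by
    have ih := @mem_choiceLists α F l cs
    rw [List.forall₂_cons, ← ih, choiceLists, Finset.mem_map]
    constructor
    · rintro ⟨⟨_, _⟩, hx, h⟩
      obtain ⟨rfl, rfl⟩ := List.cons.inj h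
      simpa using hx
    · exact fun hx => ⟨(c, cs), by simpa using hx, rfl⟩

theorem card_choiceLists {α : Type*} (F : ℕ → Finset α) (l : List ℕ) :
    (choiceLists F l).card = (l.map fun k => (F k).card).prod := by
  induction l with
  | nil => simp [choiceLists]
  | cons k l ih => simp [choiceLists, ih]

section coloured

variable {α : Type*} {L : ℕ → Set α}

theorem runLengths_prod_injective : Function.Injective
    fun x : DyckWord × List α => (⟨runLengths x.1.toList, x.2⟩ : Σ _ : List ℕ, List α) := by
  rintro ⟨P, cs⟩ ⟨Q, ds⟩ h
  simp only [Sigma.mk.injEq, heq_eq_eq] at h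
  exact Prod.ext (DyckWord.runLengths_toList_injective h.1) h.2

theorem image_colouredDyck (hL : ∀ k, (L k).Finite) (n : ℕ) :
    (fun x : DyckWord × List α => (⟨runLengths x.1.toList, x.2⟩ : Σ _ : List ℕ, List α)) ''
      colouredDyck L n = ((lukWords (n + 1) 1).sigma fun l =>
        choiceLists (fun k => (hL k).toFinset) (l.filter fun k => k ≠ 0) :
          Finset (Σ _ : List ℕ, List α)) := by
  ext ⟨l, cs⟩
  simp only [Set.mem_image, colouredDyck, Set.mem_ofPred_eq, Finset.mem_coe, Finset.mem_sigma,
    mem_choiceLists, Set.Finite.mem_toFinset, Sigma.mk.injEq, heq_eq_eq, Prod.exists]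
  constructor
  · rintro ⟨P, _, ⟨rfl, hP⟩, rfl, rfl⟩
    exact ⟨P.runLengths_toList_mem_lukWords, hP⟩
  · rintro ⟨hl, hcs⟩
    obtain ⟨P, hP, rfl⟩ := DyckWord.exists_runLengths_toList_eq hl
    exact ⟨P, cs, ⟨hP, hcs⟩, rfl, rfl⟩

theorem finite_colouredDyck (hL : ∀ k, (L k).Finite) (n : ℕ) : (colouredDyck L n).Finite := by
  refine Set.Finite.of_finite_image ?_ runLengths_prod_injective.injOn
  rw [image_colouredDyck hL]
  exact Finset.finite_toSet _

/-- Empty runs are not ascents and receive no colour, hence weight 1 for the letter 0. -/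
theorem ncard_colouredDyck (hL : ∀ k, (L k).Finite) (n : ℕ) : ((colouredDyck L n).ncard : ℚ) =
    lukSum (fun k => if k = 0 then 1 else ((L k).ncard : ℚ)) (n + 1) 1 := by
  rw [← Set.ncard_image_of_injective _ runLengths_prod_injective, image_colouredDyck hL,
    Set.ncard_coe_finset, Finset.card_sigma, Nat.cast_sum, lukSum]
  refine Finset.sum_congr rfl fun l hl => ?_
  clear hl
  rw [card_choiceLists]
  induction l with
  | nil => simp
  | cons k l ih =>
    by_cases hk : k = 0
    · simpa [hk] using ih
    · rw [List.filter_cons_of_pos (by simpa using hk), List.map_cons, List.map_cons, List.prod_cons,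
        List.prod_cons, Nat.cast_mul, ih, if_neg hk, Set.ncard_eq_toFinset_card _ (hL k)]

end coloured

open PowerSeries in
theorem ncard_colouredDyck_boundedDyck (m n : ℕ) :
    (2 * n + 1 : ℚ) * ((colouredDyck (boundedDyck m) n).ncard : ℚ) =
      coeff n (PowerSeries.mk (fun a => if a ≤ m then (1 : ℚ) else 0) ^ (2 * n + 1)) := by
  rw [ncard_colouredDyck (finite_boundedDyck m)]
  -- The exceptional weight at 0 fits the general formula: the only word of length 1 from height 1
  -- is `[0]`.
  have hc : (fun k => if k = 0 then 1 else ((boundedDyck m k).ncard : ℚ)) =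
      fun k => lukSum (fun a => if a ≤ m then 1 else 0) (k + 1) 1 := by
    funext k
    rw [ncard_boundedDyck]
    split_ifs with hk
    · simp [hk, lukSum_succ_succ]
    · rfl
  have h1 := lukSum_mul_length (fun k => lukSum (fun a => if a ≤ m then 1 else 0) (k + 1) 1)
    (n + 1) 1 n (by omega)
  have h2 := lukSum_mul_length (fun a => if a ≤ m then 1 else 0) (2 * n + 1) (n + 1) n (by omega)
  rw [coeff_mk_lukSum_pow, show n + (n + 1) = 2 * n + 1 by omega] at h1
  have h0 : (n + 1 : ℚ) ≠ 0 := by positivity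
  rw [hc]
  apply mul_left_cancel₀ h0
  push_cast at h1 h2
  rw [← h2, mul_left_comm, h1]
  ring

/-! ### Noncrossing partitions as Łukasiewicz paths -/

section Noncrossing

variable {N : ℕ}

/-- The height before position `j` of the path with steps `s i - 1`. -/
def lukHeight (s : Fin N → ℕ) (j : ℕ) : ℤ :=
  (∑ i with i.val < j, (s i : ℤ)) - j

theorem lukHeight_succ (s : Fin N → ℕ) (x : Fin N) :
    lukHeight s (x + 1) = lukHeight s x + s x - 1 := by
  have : Finset.univ.filter (fun i : Fin N => i.val < x.val + 1) =
      insert x (Finset.univ.filter fun i : Fin N => i.val < x.val) := by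
    ext i
    simp only [Finset.mem_filter, Finset.mem_univ, true_and, Finset.mem_insert, Fin.ext_iff]
    omega
  rw [lukHeight, lukHeight, this, Finset.sum_insert (by simp)]
  push_cast
  ring

@[simp] theorem lukHeight_zero (s : Fin N → ℕ) : lukHeight s 0 = 0 := by simp [lukHeight]

theorem lukHeight_self (s : Fin N → ℕ) : lukHeight s N = ∑ i, (s i : ℤ) - N := by
  simp [lukHeight]

/-- The path with steps `s i - 1` is nonnegative and ends at height `0`. -/
def IsLukFun (s : Fin N → ℕ) : Prop :=
  (∀ j ≤ N, 0 ≤ lukHeight s j) ∧ lukHeight s N = 0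

/-- A map sending every point to the least point of its block in a noncrossing partition. -/
structure IsNoncrossing (r : Fin N → Fin N) : Prop where
  le : ∀ x, r x ≤ x
  idem : ∀ x, r (r x) = r x
  nc : ∀ a b c d, a < b → b < c → c < d → r a = r c → r b = r d → r a = r b

/-- The sizes of the blocks, listed at their least points. -/
def fiberCard (r : Fin N → Fin N) (p : Fin N) : ℕ := (Finset.univ.filter fun x => r x = p).card

/-- The sizes written before `j` count all points of the blocks opened before `j`. Subtracting the
`j` points already passed leaves the pending points of these blocks. -/
theorem lukHeight_fiberCard {r : Fin N → Fin N} (hr : ∀ x, r x ≤ x) {j : ℕ} (hj : j ≤ N) :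
    lukHeight (fiberCard r) j =
      (Finset.univ.filter fun x : Fin N => j ≤ x.val ∧ (r x).val < j).card := by
  have h1 : ∑ i : Fin N with i.val < j, fiberCard r i =
      (Finset.univ.filter fun x : Fin N => (r x).val < j).card := by
    rw [Finset.card_eq_sum_card_fiberwise (f := r)
      (t := Finset.univ.filter fun i : Fin N => i.val < j)]
    · refine Finset.sum_congr rfl fun i hi => ?_
      rw [fiberCard, Finset.filter_filter]
      congr 1
      ext x
      simp only [Finset.mem_filter, Finset.mem_univ, true_and] at hi ⊢
      exact ⟨fun h => ⟨h ▸ hi, h⟩, fun h => h.2⟩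
    · intro x hx
      simpa using hx
  have h2 : (Finset.univ.filter fun x : Fin N => (r x).val < j) =
      (Finset.univ.filter fun x : Fin N => j ≤ x.val ∧ (r x).val < j) ∪
        Finset.univ.filter fun x : Fin N => x.val < j := by
    ext x
    have := Fin.le_def.1 (hr x)
    simp only [Finset.mem_filter, Finset.mem_univ, true_and, Finset.mem_union]
    omega
  have h3 : (Finset.univ.filter fun x : Fin N => x.val < j).card = j := by
    rw [Fin.card_filter_val_lt, min_eq_right hj]
  rw [lukHeight, ← Nat.cast_sum, h1, h2, Finset.card_union_of_disjoint, h3]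
  · push_cast; ring
  · rw [Finset.disjoint_left]
    intro x
    simp only [Finset.mem_filter, Finset.mem_univ, true_and]
    omega

/-- `p` is the least point of the block of `x` in the noncrossing partition encoded by `s`. -/
def IsBlockMin (s : Fin N → ℕ) (p x : Fin N) : Prop :=
  (0 < s x ∧ p = x) ∨ (s x = 0 ∧ p < x ∧ lukHeight s p < lukHeight s x ∧
    ∀ j : ℕ, p.val < j → j < x.val → lukHeight s x ≤ lukHeight s j)

/-- When `s x = 0`, the point `p` is the last position before `x` of height less than that of `x`.
-/
theorem IsBlockMin.unique {s : Fin N → ℕ} {p q x : Fin N} (hp : IsBlockMin s p x)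
    (hq : IsBlockMin s q x) : p = q := by
  rcases hp with ⟨h1, rfl⟩ | ⟨h1, h2, h3, h4⟩ <;> rcases hq with ⟨h1', rfl⟩ | ⟨h1', h2', h3', h4'⟩
  · rfl
  · omega
  · omega
  · rcases lt_trichotomy p q with h | h | h
    · exact absurd (h4 q h h2') (not_le.2 h3')
    · exact h
    · exact absurd (h4' p h h2) (not_le.2 h3)

theorem IsNoncrossing.isBlockMin {r : Fin N → Fin N} (hr : IsNoncrossing r) (x : Fin N) :
    IsBlockMin (fiberCard r) (r x) x := by
  by_cases hx : r x = x
  · exact Or.inl ⟨Finset.card_pos.2 ⟨x, by simpa using hx⟩, hx⟩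
  have hlt : r x < x := lt_of_le_of_ne (hr.le x) hx
  refine Or.inr ⟨?_, hlt, ?_, fun j h1 h2 => ?_⟩
  · rw [fiberCard, Finset.card_eq_zero, Finset.filter_eq_empty_iff]
    rintro y - rfl
    exact hx (hr.idem y)
  -- Points pending at `r x` are still pending at `x`, since noncrossing forbids them between `r x`
  -- and `x`; the point `x` itself is pending only at `x`.
  · rw [lukHeight_fiberCard hr.le (by omega), lukHeight_fiberCard hr.le (by omega), Nat.cast_lt]
    apply Finset.card_lt_card
    rw [Finset.ssubset_iff_of_subset]
    · exact ⟨x, by simpa using hlt, by simp⟩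
    · intro y hy
      simp only [Finset.mem_filter, Finset.mem_univ, true_and, Fin.val_fin_le,
        Fin.val_fin_lt] at hy ⊢
      refine ⟨?_, hy.2.trans hlt⟩
      by_contra! hyx
      have hne : r x ≠ y := by
        rintro rfl
        rw [hr.idem] at hy
        exact lt_irrefl _ hy.2
      have := hr.nc (r y) (r x) y x hy.2 (lt_of_le_of_ne hy.1 hne) hyx (hr.idem y) (hr.idem x)
      rw [hr.idem, hr.idem] at this
      exact hy.2.ne this
  -- A block opened in `[j, x)` and still pending at `x` would cross the block of `x`.
  · rw [lukHeight_fiberCard hr.le (by omega), lukHeight_fiberCard hr.le (by omega), Nat.cast_le]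
    apply Finset.card_le_card
    intro y hy
    simp only [Finset.mem_filter, Finset.mem_univ, true_and, Fin.val_fin_le,
        Fin.val_fin_lt] at hy ⊢
    refine ⟨by have := Fin.le_def.1 hy.1; omega, ?_⟩
    by_contra! hj
    have hpq : r x < r y := Fin.lt_def.2 (by omega)
    have hxy : x < y := lt_of_le_of_ne hy.1 (by rintro rfl; exact lt_irrefl _ hpq)
    have := hr.nc (r x) (r y) x y hpq hy.2 hxy (hr.idem x) (hr.idem y)
    rw [hr.idem, hr.idem] at this
    exact hpq.ne this

theorem fiberCard_injOn : Set.InjOn (fiberCard (N := N)) {r | IsNoncrossing r} := by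
  intro r hr r' hr' h
  funext x
  have := hr.isBlockMin x
  rw [h] at this
  exact this.unique (hr'.isBlockMin x)

theorem IsNoncrossing.isLukFun {r : Fin N → Fin N} (hr : IsNoncrossing r) :
    IsLukFun (fiberCard r) := by
  refine ⟨fun j hj => ?_, ?_⟩
  · rw [lukHeight_fiberCard hr.le hj]
    positivity
  · rw [lukHeight_fiberCard hr.le le_rfl, Nat.cast_eq_zero, Finset.card_eq_zero,
      Finset.filter_eq_empty_iff]
    intro x _
    omega

theorem IsLukFun.exists_isBlockMin {s : Fin N → ℕ} (hs : IsLukFun s) (x : Fin N) :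
    ∃ p, IsBlockMin s p x := by
  obtain hx | hx := Nat.eq_zero_or_pos (s x)
  · have h1 := hs.1 (x + 1) x.isLt
    rw [lukHeight_succ, hx] at h1
    have hx0 : x.val ≠ 0 := by
      intro h
      rw [h, lukHeight_zero] at h1
      simp at h1
    -- Position 0 qualifies: a zero letter at `x` lowers the height, which must stay nonnegative, so
    -- the height before `x` is positive.
    have hne : (Finset.univ.filter fun j : Fin N =>
        j < x ∧ lukHeight s j < lukHeight s x).Nonempty :=
      ⟨⟨0, by omega⟩, by
        simp only [Finset.mem_filter, Finset.mem_univ, true_and, Fin.lt_def, lukHeight_zero]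
        push_cast at h1
        omega⟩
    obtain ⟨p, hp, hmax⟩ := Finset.exists_max_image _ id hne
    simp only [Finset.mem_filter, Finset.mem_univ, true_and, id] at hp hmax
    refine ⟨p, Or.inr ⟨hx, hp.1, hp.2, fun j h1 h2 => ?_⟩⟩
    by_contra! hj
    have := hmax ⟨j, by omega⟩ ⟨h2, hj⟩
    rw [Fin.le_def] at this
    simp only at this
    omega
  · exact ⟨x, Or.inl ⟨hx, rfl⟩⟩

theorem IsBlockMin.lukHeight_le {s : Fin N → ℕ} {p x : Fin N} (h : IsBlockMin s p x)
    (hx : p ≠ x) : lukHeight s x ≤ lukHeight s p + s p - 1 := by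
  rcases h with ⟨-, rfl⟩ | ⟨h1, h2, h3, h4⟩
  · exact absurd rfl hx
  rw [← lukHeight_succ]
  obtain h | h := eq_or_lt_of_le (show p.val + 1 ≤ x.val from h2)
  · rw [h]
  · exact h4 _ (by omega) h

theorem IsBlockMin.pos {s : Fin N → ℕ} {p x : Fin N} (h : IsBlockMin s p x) : 0 < s p := by
  by_cases hx : p = x
  · rcases h with ⟨h1, rfl⟩ | ⟨h1, h2, h3, h4⟩
    · exact h1
    · exact absurd hx h2.ne
  · have := h.lukHeight_le hx
    rcases h with ⟨-, rfl⟩ | ⟨h1, h2, h3, h4⟩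
    · exact absurd rfl hx
    · omega

theorem IsBlockMin.of_ne {s : Fin N → ℕ} {p x : Fin N} (h : IsBlockMin s p x) (hx : p ≠ x) :
    s x = 0 ∧ p < x ∧ lukHeight s p < lukHeight s x ∧
      ∀ j : ℕ, p.val < j → j < x.val → lukHeight s x ≤ lukHeight s j :=
  h.resolve_left fun h' => hx h'.2

theorem isNoncrossing_of_isBlockMin {s : Fin N → ℕ} {r : Fin N → Fin N}
    (hr : ∀ x, IsBlockMin s (r x) x) : IsNoncrossing r where
  le x := by
    rcases hr x with ⟨-, h⟩ | ⟨-, h, -⟩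
    · exact h.le
    · exact h.le
  idem x := (hr (r x)).unique (Or.inl ⟨(hr x).pos, rfl⟩)
  nc a b c d hab hbc hcd hac hbd := by
    have hle : ∀ x, r x ≤ x := fun x => by
      rcases hr x with ⟨-, h⟩ | ⟨-, h, -⟩
      · exact h.le
      · exact h.le
    have ha := hle a
    have hb := hle b
    have hc := (hr c).of_ne (by rw [← hac]; exact (ha.trans_lt (hab.trans hbc)).ne)
    have hd := (hr d).of_ne (by rw [← hbd]; exact (hb.trans_lt (hbc.trans hcd)).ne)
    rw [← hac] at hc
    rw [← hbd] at hd
    -- Different minima give a cycle of heights: `c ≤ r b < d ≤ c` in one order, `b ≤ r a < c ≤ b`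
    -- in the other.
    rcases lt_trichotomy (r a) (r b) with h | h | h
    · have h1 := hc.2.2.2 (r b) h (hb.trans_lt hbc)
      have h2 := hd.2.2.2 c (hb.trans_lt hbc) hcd
      have h3 := hd.2.2.1
      omega
    · exact h
    · have hb' := (hr b).of_ne (h.trans_le (ha.trans hab.le)).ne
      have h1 := hb'.2.2.2 (r a) h (ha.trans_lt hab)
      have h2 := hc.2.2.2 b (ha.trans_lt hab) hbc
      have h3 := hc.2.2.1
      omega

/-- The points of the block other than `p` have distinct heights strictly between that of `p` and
that plus `s p`, so there are at most `s p - 1` of them. -/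
theorem fiberCard_le_of_isBlockMin {s : Fin N → ℕ} {r : Fin N → Fin N}
    (hr : ∀ x, IsBlockMin s (r x) x) (p : Fin N) : fiberCard r p ≤ s p := by
  obtain h0 | h0 := Nat.eq_zero_or_pos (s p)
  · rw [h0, Nat.le_zero, fiberCard, Finset.card_eq_zero, Finset.filter_eq_empty_iff]
    rintro x - rfl
    exact (hr x).pos.ne' h0
  have hsub : Finset.univ.filter (fun x => r x = p) ⊆
      insert p (Finset.univ.filter fun x => r x = p ∧ p ≠ x) := by
    intro x hx
    simp only [Finset.mem_filter, Finset.mem_univ, true_and, Finset.mem_insert] at hx ⊢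
    by_cases h : x = p
    · exact Or.inl h
    · exact Or.inr ⟨hx, fun h' => h h'.symm⟩
  have hcard : (Finset.univ.filter fun x => r x = p ∧ p ≠ x).card ≤
      (Finset.Ioo (lukHeight s p) (lukHeight s p + s p)).card := by
    apply Finset.card_le_card_of_injOn (fun x : Fin N => lukHeight s x.val)
    · intro x hx
      simp only [Finset.coe_filter, Finset.mem_univ, true_and, Set.mem_ofPred_eq] at hx
      have hx' := hr x
      rw [hx.1] at hx'
      have h1 := hx'.lukHeight_le hx.2
      have h2 := (hx'.of_ne hx.2).2.2.1
      simp only [Finset.coe_Ioo, Set.mem_Ioo]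
      omega
    -- Heights strictly decrease along the block after `p`: the zero letter at `x` steps down by
    -- one, and `y` is no higher than any position between `p` and `y`.
    · have key : ∀ x y : Fin N, r x = p → p ≠ x → r y = p → p ≠ y → x < y →
          lukHeight s x ≠ lukHeight s y := by
        intro x y hx hpx hy hpy hxy
        have hx' := hr x
        have hy' := hr y
        rw [hx] at hx'
        rw [hy] at hy'
        have h1 := hx'.of_ne hpx
        have h2 := hy'.of_ne hpy
        have h3 := lukHeight_succ s x
        rw [h1.1] at h3
        have h4 : lukHeight s y ≤ lukHeight s (x + 1) := by
          obtain h | h := eq_or_lt_of_le (show x.val + 1 ≤ y.val from hxy)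
          · rw [h]
          · exact h2.2.2.2 _ (by have := Fin.lt_def.1 h1.2.1; omega) h
        push_cast at h3
        omega
      intro x hx y hy hxy
      simp only [Finset.coe_filter, Finset.mem_univ, true_and, Set.mem_ofPred_eq] at hx hy
      rcases lt_trichotomy x y with h | h | h
      · exact absurd hxy (key x y hx.1 hx.2 hy.1 hy.2 h)
      · exact h
      · exact absurd hxy.symm (key y x hy.1 hy.2 hx.1 hx.2 h)
  rw [Int.card_Ioo] at hcard
  have := (Finset.card_le_card hsub).trans (Finset.card_insert_le _ _)
  rw [fiberCard]
  omega

theorem IsLukFun.exists_isNoncrossing {s : Fin N → ℕ} (hs : IsLukFun s) :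
    ∃ r, IsNoncrossing r ∧ fiberCard r = s := by
  choose r hr using hs.exists_isBlockMin
  refine ⟨r, isNoncrossing_of_isBlockMin hr, ?_⟩
  have h1 : ∑ p, fiberCard r p = N := by
    have := Finset.card_eq_sum_card_fiberwise (f := r) (s := Finset.univ) (t := Finset.univ)
      (fun x _ => by simp)
    rw [Finset.card_univ, Fintype.card_fin] at this
    exact this.symm
  have h2 : ∑ p, s p = N := by
    have := hs.2
    rw [lukHeight_self] at this
    exact_mod_cast sub_eq_zero.1 this
  -- A pointwise inequality between families with the same sum `N` is an equality.
  funext p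
  exact (Finset.sum_eq_sum_iff_of_le fun p _ => fiberCard_le_of_isBlockMin hr p).1
    (h1.trans h2.symm) p (Finset.mem_univ p)

theorem lukHeight_succ_eq (s : Fin (N + 1) → ℕ) (j : ℕ) :
    lukHeight s (j + 1) = s 0 - 1 + lukHeight (fun i => s i.succ) j := by
  have : Finset.univ.filter (fun i : Fin (N + 1) => i.val < j + 1) =
      insert 0 ((Finset.univ.filter fun i : Fin N => i.val < j).map (Fin.succEmb N)) := by
    ext i
    cases i using Fin.cases with
    | zero => simp
    | succ i => simp [Fin.succ_ne_zero]
  rw [lukHeight, lukHeight, this, Finset.sum_insert (by simp [Fin.succ_ne_zero]), Finset.sum_map]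
  simp only [Fin.coe_succEmb]
  push_cast
  ring

/-- Starting one unit higher turns nonnegative heights into positive ones; the appended 0 makes the
final descent. -/
theorem isLuk_ofFn_append_zero : ∀ (N : ℕ) (s : Fin N → ℕ) (h : ℕ),
    IsLuk (h + 1) (List.ofFn s ++ [0]) ↔
      (∀ j ≤ N, 0 ≤ h + lukHeight s j) ∧ h + lukHeight s N = 0
  | 0, s, h => by
    simp only [List.ofFn_zero, List.nil_append, IsLuk, Nat.le_zero, forall_eq, lukHeight_zero]
    omega
  | N + 1, s, h => by
    rw [List.ofFn_succ, List.cons_append, IsLuk]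
    obtain h0 | ⟨h', h0⟩ : h + s 0 = 0 ∨ ∃ h', h + s 0 = h' + 1 := by
      cases h + s 0 with
      | zero => exact Or.inl rfl
      | succ k => exact Or.inr ⟨k, rfl⟩
    · have hf : ¬ IsLuk 0 (List.ofFn (fun i : Fin N => s i.succ) ++ [0]) := by
        cases List.ofFn (fun i : Fin N => s i.succ) <;> simp [IsLuk]
      rw [h0, iff_false_left hf]
      rintro ⟨H, -⟩
      have := H 1 (by omega)
      have h1 := lukHeight_succ_eq s 0
      rw [lukHeight_zero, zero_add] at h1
      omega
    · rw [h0, isLuk_ofFn_append_zero N _ h']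
      have e : ∀ j, (h : ℤ) + lukHeight s (j + 1) = h' + lukHeight (fun i => s i.succ) j := by
        intro j
        rw [lukHeight_succ_eq]
        omega
      rw [e]
      refine and_congr_left fun _ => ⟨fun H j hj => ?_, fun H j hj => ?_⟩
      · cases j with
        | zero => simp
        | succ j => rw [e]; exact H j (by omega)
      · rw [← e]; exact H (j + 1) (by omega)

theorem IsLuk.last_eq_zero {a : ℕ} : ∀ {l : List ℕ} {h : ℕ}, IsLuk h (l ++ [a]) → a = 0
  | [], 0, hl => by simp [IsLuk] at hl
  | [], h + 1, hl => by
    simp only [List.nil_append, IsLuk] at hl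
    omega
  | _ :: _, 0, hl => by simp [IsLuk] at hl
  | b :: l, h + 1, hl => IsLuk.last_eq_zero (l := l) (h := h + b) hl

theorem image_ofFn_isLukFun (Q : ℕ → Prop) [DecidablePred Q] (hQ : Q 0) :
    (fun s : Fin N → ℕ => List.ofFn s ++ [0]) '' {s | IsLukFun s ∧ ∀ p, Q (s p)} =
      ((lukWords (N + 1) 1).filter fun l => ∀ a ∈ l, Q a : Finset (List ℕ)) := by
  ext l
  simp only [Set.mem_image, Set.mem_ofPred_eq, Finset.coe_filter, mem_lukWords]
  constructor
  · rintro ⟨s, ⟨h1, h2⟩, rfl⟩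
    refine ⟨⟨by simp, ?_⟩, ?_⟩
    · rw [show (1 : ℕ) = 0 + 1 from rfl, isLuk_ofFn_append_zero]
      simpa [IsLukFun] using h1
    · intro a ha
      rw [List.mem_append, List.mem_ofFn', Set.mem_range, List.mem_singleton] at ha
      rcases ha with ⟨p, rfl⟩ | rfl
      · exact h2 p
      · exact hQ
  · rintro ⟨⟨h1, h2⟩, h3⟩
    obtain ⟨l, a, rfl⟩ := List.eq_nil_or_concat' l |>.resolve_left (by rintro rfl; simp at h1)
    obtain rfl := h2.last_eq_zero
    obtain rfl : l.length = N := by simpa using h1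
    refine ⟨l.get, ⟨?_, fun p => h3 _ (by simp)⟩, by rw [List.ofFn_get]⟩
    have h4 : IsLuk (0 + 1) (List.ofFn l.get ++ [0]) := by rwa [List.ofFn_get]
    rw [isLuk_ofFn_append_zero] at h4
    simpa [IsLukFun] using h4

theorem image_fiberCard (Q : ℕ → Prop) :
    fiberCard '' {r : Fin N → Fin N | IsNoncrossing r ∧ ∀ p, Q (fiberCard r p)} =
      {s | IsLukFun s ∧ ∀ p, Q (s p)} := by
  ext s
  constructor
  · rintro ⟨r, ⟨h1, h2⟩, rfl⟩
    exact ⟨h1.isLukFun, h2⟩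
  · rintro ⟨h1, h2⟩
    obtain ⟨r, hr, rfl⟩ := h1.exists_isNoncrossing
    exact ⟨r, ⟨hr, h2⟩, rfl⟩

theorem ncard_isNoncrossing (Q : ℕ → Prop) [DecidablePred Q] (hQ : Q 0) :
    (({r : Fin N → Fin N | IsNoncrossing r ∧ ∀ p, Q (fiberCard r p)} : Set _).ncard : ℚ) =
      lukSum (fun a => if Q a then 1 else 0) (N + 1) 1 := by
  rw [← (fiberCard_injOn.mono fun r hr => hr.1).ncard_image, image_fiberCard,
    ← Set.ncard_image_of_injective (f := fun s : Fin N → ℕ => List.ofFn s ++ [0]),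
    image_ofFn_isLukFun Q hQ, Set.ncard_coe_finset, card_filter_lukWords]
  intro s s' h
  exact List.ofFn_injective (List.append_cancel_right h)

end Noncrossing

/-! ### Crossing blocks and convex hulls -/

section Geometry

variable {N : ℕ} {v : Fin N → EuclideanSpace ℝ (Fin 2)}

theorem IsConvexPolygon.exists_mem_segment_of_crossing (hv : IsConvexPolygon v) {a b c d : Fin N}
    (hab : a < b) (hbc : b < c) (hcd : c < d) :
    ∃ x, x ∈ segment ℝ (v a) (v c) ∧ x ∈ segment ℝ (v b) (v d) := by
  have h1 := hv.2 a b c hab hbc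
  have h2 := hv.2 b c d hbc hcd
  have h3 := hv.2 a c d (hab.trans hbc) hcd
  have h4 := hv.2 a b d hab (hbc.trans hcd)
  -- Doubled signed areas of `abc`, `bcd`, `acd`, `abd`. The two triangulations of the quadrilateral
  -- give `B + D = C + A`, and these areas are the weights of the intersection of the diagonals.
  set A := (v b 0 - v a 0) * (v c 1 - v a 1) - (v b 1 - v a 1) * (v c 0 - v a 0) with hA
  set B := (v c 0 - v b 0) * (v d 1 - v b 1) - (v c 1 - v b 1) * (v d 0 - v b 0) with hB
  set C := (v c 0 - v a 0) * (v d 1 - v a 1) - (v c 1 - v a 1) * (v d 0 - v a 0) with hC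
  set D := (v b 0 - v a 0) * (v d 1 - v a 1) - (v b 1 - v a 1) * (v d 0 - v a 0) with hD
  have hsum : B + D = C + A := by rw [hA, hB, hC, hD]; ring
  have hs : B + D ≠ 0 := by linarith
  refine ⟨(B / (B + D)) • v a + (D / (B + D)) • v c, ⟨_, _, ?_, ?_, ?_, rfl⟩,
    ⟨C / (B + D), A / (B + D), ?_, ?_, ?_, ?_⟩⟩
  · exact div_nonneg_of_nonpos h2.le (by linarith)
  · exact div_nonneg_of_nonpos h4.le (by linarith)
  · rw [← add_div, div_self hs]
  · exact div_nonneg_of_nonpos h3.le (by linarith)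
  · exact div_nonneg_of_nonpos h1.le (by linarith)
  · rw [← add_div, ← hsum, div_self hs]
  · ext i
    have : C * v b i + A * v d i = B * v a i + D * v c i := by
      fin_cases i <;> simp only [hA, hB, hC, hD, Fin.zero_eta, Fin.mk_one] <;> ring
    simp only [PiLp.add_apply, PiLp.smul_apply, smul_eq_mul]
    field_simp
    exact this

/-- The line through two vertices separates the vertices between them from the others. -/
theorem IsConvexPolygon.disjoint_convexHull (hv : IsConvexPolygon v) {p q : Fin N} (hpq : p < q)
    {B C : Set (Fin N)} (hB : ∀ x ∈ B, p ≤ x ∧ x ≤ q) (hC : ∀ x ∈ C, x < p ∨ q < x) :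
    Disjoint (convexHull ℝ (v '' B)) (convexHull ℝ (v '' C)) := by
  -- `f x - f (v p)` is the cross product of `v q - v p` and `x - v p`; its sign tells the side of
  -- the line.
  let f : EuclideanSpace ℝ (Fin 2) →ₗ[ℝ] ℝ :=
    { toFun := fun x => (v q 0 - v p 0) * x 1 - (v q 1 - v p 1) * x 0
      map_add' := fun x y => by simp only [PiLp.add_apply]; ring
      map_smul' := fun t x => by
        simp only [PiLp.smul_apply, smul_eq_mul, RingHom.id_apply]; ring }
  have hf : ∀ x, f x = (v q 0 - v p 0) * x 1 - (v q 1 - v p 1) * x 0 := fun _ => rfl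
  have h1 : convexHull ℝ (v '' B) ⊆ {x | f (v p) ≤ f x} := by
    refine convexHull_min ?_ (convex_halfSpace_ge f.isLinear _)
    rintro _ ⟨x, hx, rfl⟩
    obtain ⟨hpx, hxq⟩ := hB x hx
    rw [Set.mem_ofPred_eq, hf, hf]
    obtain rfl | hpx := eq_or_lt_of_le hpx
    · exact le_rfl
    obtain rfl | hxq := eq_or_lt_of_le hxq
    · linarith
    have := hv.2 p x q hpx hxq
    linarith
  have h2 : convexHull ℝ (v '' C) ⊆ {x | f x < f (v p)} := by
    refine convexHull_min ?_ (convex_halfSpace_lt f.isLinear _)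
    rintro _ ⟨x, hx, rfl⟩
    rw [Set.mem_ofPred_eq, hf, hf]
    obtain hx | hx := hC x hx
    · have := hv.2 x p q hx hpq
      linarith
    · have := hv.2 p q x hpq hx
      linarith
  rw [Set.disjoint_left]
  intro x hx hx'
  have h3 : f x < f (v p) := h2 hx'
  exact h3.not_ge (h1 hx)

/-- Two blocks do not cross. -/
def NotCross (B C : Finset (Fin N)) : Prop :=
  ∀ a ∈ B, ∀ b ∈ C, ∀ c ∈ B, ∀ d ∈ C, ¬ (a < b ∧ b < c ∧ c < d)

theorem IsConvexPolygon.notCross (hv : IsConvexPolygon v) {B C : Finset (Fin N)}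
    (h : Disjoint (convexHull ℝ (v '' (B : Set (Fin N))))
      (convexHull ℝ (v '' (C : Set (Fin N))))) : NotCross B C := by
  rintro a ha b hb c hc d hd ⟨hab, hbc, hcd⟩
  obtain ⟨x, hx, hx'⟩ := hv.exists_mem_segment_of_crossing hab hbc hcd
  exact Set.disjoint_left.1 h (segment_subset_convexHull (Set.mem_image_of_mem v ha)
      (Set.mem_image_of_mem v hc) hx)
    (segment_subset_convexHull (Set.mem_image_of_mem v hb) (Set.mem_image_of_mem v hd) hx')

/-- Either `C` avoids the range from the minimum to the maximum of `B`, or noncrossing nests `C` in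
a gap of `B`, so `B` avoids the range of `C`. The line through the two extremes then separates; this
requires two points in the block. -/
theorem IsConvexPolygon.disjoint_of_notCross (hv : IsConvexPolygon v) {B C : Finset (Fin N)}
    (hB : 1 < B.card) (hC : 1 < C.card) (hd : Disjoint B C) (h1 : NotCross B C)
    (h2 : NotCross C B) :
    Disjoint (convexHull ℝ (v '' (B : Set (Fin N)))) (convexHull ℝ (v '' (C : Set (Fin N)))) := by
  have hB0 : B.Nonempty := Finset.card_pos.1 (by omega)
  have hC0 : C.Nonempty := Finset.card_pos.1 (by omega)
  have hBlt : B.min' hB0 < B.max' hB0 := Finset.min'_lt_max'_of_card B hB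
  have hClt : C.min' hC0 < C.max' hC0 := Finset.min'_lt_max'_of_card C hC
  have hne : ∀ x ∈ B, ∀ y ∈ C, x ≠ y := fun x hx y hy h => Finset.disjoint_left.1 hd hx (h ▸ hy)
  by_cases hin : ∀ x ∈ C, x < B.min' hB0 ∨ B.max' hB0 < x
  · exact hv.disjoint_convexHull hBlt
      (fun x hx => ⟨B.min'_le x hx, B.le_max' x hx⟩) hin
  push Not at hin
  obtain ⟨y, hy, hy1, hy2⟩ := hin
  have hy1 := lt_of_le_of_ne hy1 (hne _ (B.min'_mem hB0) _ hy)
  have hy2 := lt_of_le_of_ne hy2 (hne _ (B.max'_mem hB0) _ hy).symm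
  refine (hv.disjoint_convexHull hClt (fun x hx => ⟨C.min'_le x hx, C.le_max' x hx⟩) ?_).symm
  intro x hx
  by_contra! hx'
  have hx1 := lt_of_le_of_ne hx'.1 (hne _ hx _ (C.min'_mem hC0)).symm
  have hx2 := lt_of_le_of_ne hx'.2 (hne _ hx _ (C.max'_mem hC0))
  have hmin : B.min' hB0 < C.min' hC0 := by
    refine lt_of_not_ge fun h => ?_
    have h := lt_of_le_of_ne h (hne _ (B.min'_mem hB0) _ (C.min'_mem hC0)).symm
    exact h2 _ (C.min'_mem hC0) _ (B.min'_mem hB0) y hy _ (B.max'_mem hB0) ⟨h, hy1, hy2⟩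
  exact h1 _ (B.min'_mem hB0) _ (C.min'_mem hC0) x hx _ (C.max'_mem hC0) ⟨hmin, hx1, hx2⟩

end Geometry

/-! ### Set partitions through their block minima -/

section Partitions

variable {N : ℕ}

/-- The least point of the block of `x`. -/
def blockMin (π : Finpartition (Finset.univ : Finset (Fin N))) (x : Fin N) : Fin N :=
  (π.part x).min' ⟨x, π.mem_part_self.2 (Finset.mem_univ x)⟩

variable (π : Finpartition (Finset.univ : Finset (Fin N)))

theorem blockMin_mem (x : Fin N) : blockMin π x ∈ π.part x := Finset.min'_mem _ _

theorem part_eq_part_iff_mem {x y : Fin N} : π.part x = π.part y ↔ x ∈ π.part y :=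
  (π.mem_part_iff_part_eq_part (Finset.mem_univ _) (Finset.mem_univ _)).symm

theorem part_blockMin (x : Fin N) : π.part (blockMin π x) = π.part x :=
  (part_eq_part_iff_mem π).2 (blockMin_mem π x)

theorem blockMin_eq_iff {x y : Fin N} : blockMin π x = blockMin π y ↔ π.part x = π.part y := by
  constructor
  · intro h
    rw [← part_blockMin π x, h, part_blockMin]
  · intro h
    simp only [blockMin, h]

theorem part_eq_filter (x : Fin N) :
    π.part x = Finset.univ.filter fun y => blockMin π y = blockMin π x := by
  ext y
  rw [Finset.mem_filter, blockMin_eq_iff, part_eq_part_iff_mem]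
  simp

theorem blockMin_injective :
    Function.Injective (blockMin : Finpartition (Finset.univ : Finset (Fin N)) → _) := by
  have key : ∀ π σ : Finpartition (Finset.univ : Finset (Fin N)), blockMin π = blockMin σ →
      ∀ B ∈ π.parts, B ∈ σ.parts := by
    intro π σ h B hB
    obtain ⟨x, hx⟩ := π.nonempty_of_mem_parts hB
    rw [← π.part_eq_of_mem hB hx, part_eq_filter, h, ← part_eq_filter]
    exact σ.part_mem.2 (Finset.mem_univ x)
  intro π σ h
  ext B
  exact ⟨key π σ h B, key σ π h.symm B⟩

theorem fiberCard_blockMin (x : Fin N) :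
    fiberCard (blockMin π) (blockMin π x) = (π.part x).card := by
  rw [fiberCard, part_eq_filter]

theorem forall_fiberCard_blockMin {Q : ℕ → Prop} (hQ : Q 0) :
    (∀ p, Q (fiberCard (blockMin π) p)) ↔ ∀ B ∈ π.parts, Q B.card := by
  constructor
  · intro h B hB
    obtain ⟨x, hx⟩ := π.nonempty_of_mem_parts hB
    rw [← π.part_eq_of_mem hB hx, ← fiberCard_blockMin]
    exact h _
  · intro h p
    by_cases hp : ∃ x, blockMin π x = p
    · obtain ⟨x, rfl⟩ := hp
      rw [fiberCard_blockMin]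
      exact h _ (π.part_mem.2 (Finset.mem_univ x))
    · have : fiberCard (blockMin π) p = 0 := by
        rw [fiberCard, Finset.card_eq_zero, Finset.filter_eq_empty_iff]
        exact fun x _ hx => hp ⟨x, hx⟩
      rw [this]
      exact hQ

theorem isNoncrossing_blockMin_iff :
    IsNoncrossing (blockMin π) ↔ ∀ B ∈ π.parts, ∀ C ∈ π.parts, B ≠ C → NotCross B C := by
  constructor
  · rintro h B hB C hC hBC a ha b hb c hc d hd ⟨hab, hbc, hcd⟩
    have hpa := π.part_eq_of_mem hB ha
    have hpb := π.part_eq_of_mem hC hb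
    have := h.nc a b c d hab hbc hcd
      ((blockMin_eq_iff π).2 (hpa.trans (π.part_eq_of_mem hB hc).symm))
      ((blockMin_eq_iff π).2 (hpb.trans (π.part_eq_of_mem hC hd).symm))
    rw [blockMin_eq_iff, hpa, hpb] at this
    exact hBC this
  · refine fun h => ⟨fun x => Finset.min'_le _ _ (π.mem_part_self.2 (Finset.mem_univ x)),
      fun x => (blockMin_eq_iff π).2 (part_blockMin π x), fun a b c d hab hbc hcd hac hbd => ?_⟩
    by_contra hne
    rw [blockMin_eq_iff] at hne hac hbd
    exact h _ (π.part_mem.2 (Finset.mem_univ a)) _ (π.part_mem.2 (Finset.mem_univ b)) hne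
      a (π.mem_part_self.2 (Finset.mem_univ a)) b (π.mem_part_self.2 (Finset.mem_univ b))
      c ((part_eq_part_iff_mem π).1 hac.symm) d ((part_eq_part_iff_mem π).1 hbd.symm)
      ⟨hab, hbc, hcd⟩

theorem exists_blockMin_eq {r : Fin N → Fin N} (hle : ∀ x, r x ≤ x) (hidem : ∀ x, r (r x) = r x) :
    ∃ π, blockMin π = r := by
  have : DecidableRel (Setoid.ker r) := Classical.decRel _
  refine ⟨Finpartition.ofSetoid (Setoid.ker r), funext fun x => ?_⟩
  have hmem : ∀ y, y ∈ (Finpartition.ofSetoid (Setoid.ker r)).part x ↔ r x = r y := fun y => by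
    rw [Finpartition.mem_part_ofSetoid_iff_rel]
    rfl
  apply le_antisymm
  · exact Finset.min'_le _ _ ((hmem _).2 (hidem x).symm)
  · refine Finset.le_min' _ _ _ fun y hy => ?_
    rw [(hmem y).1 hy]
    exact hle y

theorem mem_evenHullPartitions {m : ℕ} {v : Fin N → EuclideanSpace ℝ (Fin 2)}
    (hv : IsConvexPolygon v) : π ∈ evenHullPartitions m v ↔
      IsNoncrossing (blockMin π) ∧
        ∀ p, Even (fiberCard (blockMin π) p) ∧ fiberCard (blockMin π) p ≤ 2 * m := by
  rw [forall_fiberCard_blockMin π (Q := fun k => Even k ∧ k ≤ 2 * m) (by simp),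
    isNoncrossing_blockMin_iff, and_comm (b := ∀ B ∈ π.parts, _ ∧ _)]
  refine and_congr_right fun h => ?_
  -- Nonempty blocks of even size have at least two points, as the separating line requires.
  have hcard : ∀ B ∈ π.parts, 1 < B.card := fun B hB => by
    have h1 := Finset.card_pos.2 (π.nonempty_of_mem_parts hB)
    obtain ⟨k, hk⟩ := (h B hB).1
    omega
  refine ⟨fun H B hB C hC hBC => hv.notCross (H B hB C hC hBC), fun H B hB C hC hBC => ?_⟩
  exact hv.disjoint_of_notCross (hcard B hB) (hcard C hC) (π.disjoint hB hC hBC)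
    (H B hB C hC hBC) (H C hC B hB hBC.symm)

theorem image_evenHullPartitions {m : ℕ} {v : Fin N → EuclideanSpace ℝ (Fin 2)}
    (hv : IsConvexPolygon v) : blockMin '' evenHullPartitions m v =
      {r : Fin N → Fin N | IsNoncrossing r ∧ ∀ p, Even (fiberCard r p) ∧ fiberCard r p ≤ 2 * m} := by
  ext r
  constructor
  · rintro ⟨π, hπ, rfl⟩
    exact (mem_evenHullPartitions π hv).1 hπ
  · intro hr
    obtain ⟨π, rfl⟩ := exists_blockMin_eq hr.1.le hr.1.idem
    exact ⟨π, (mem_evenHullPartitions π hv).2 hr, rfl⟩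

end Partitions

/-! ### Coefficient extraction and the explicit sum -/

section Count

open PowerSeries

theorem coeff_mk_even_pow (c : ℕ → ℚ) (r n : ℕ) :
    coeff (2 * n) (PowerSeries.mk (fun a => if Even a then c (a / 2) else 0) ^ r) =
      coeff n (PowerSeries.mk c ^ r) := by
  have h : PowerSeries.mk (fun a => if Even a then c (a / 2) else 0) =
      PowerSeries.expand 2 two_ne_zero (PowerSeries.mk c) := by
    ext a
    rw [coeff_mk, PowerSeries.coeff_expand]
    simp [even_iff_two_dvd]
  rw [h, ← map_pow, PowerSeries.coeff_expand]
  simp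

theorem ncard_evenHullPartitions {n : ℕ} (m : ℕ) {v : Fin (2 * n) → EuclideanSpace ℝ (Fin 2)}
    (hv : IsConvexPolygon v) :
    (2 * n + 1 : ℚ) * ((evenHullPartitions m v).ncard : ℚ) =
      coeff n (PowerSeries.mk (fun a => if a ≤ m then (1 : ℚ) else 0) ^ (2 * n + 1)) := by
  have h1 := lukSum_mul_length (fun a => if Even a ∧ a ≤ 2 * m then 1 else 0) (2 * n + 1) 1 (2 * n)
    (by omega)
  have hc : (fun a => if Even a ∧ a ≤ 2 * m then (1 : ℚ) else 0) =
      fun a => if Even a then (fun k => if k ≤ m then (1 : ℚ) else 0) (a / 2) else 0 := by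
    funext a
    by_cases h : Even a
    · obtain ⟨k, rfl⟩ := h.exists_two_nsmul
      simp
    · simp [h]
  rw [← Set.ncard_image_of_injective _ blockMin_injective, image_evenHullPartitions hv,
    ncard_isNoncrossing (fun k => Even k ∧ k ≤ 2 * m) (by simp)]
  push_cast at h1
  rw [h1, hc, coeff_mk_even_pow (fun k => if k ≤ m then 1 else 0), one_mul]

theorem coeff_mk_le_pow (m r n : ℕ) :
    coeff n (PowerSeries.mk (fun a => if a ≤ m then (1 : ℚ) else 0) ^ (r + 1)) =
      ∑ p ∈ (Finset.range (n + 1)).filter (fun p => (m + 1) * p ≤ n),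
        (-1 : ℚ) ^ p * ((r + 1).choose p : ℚ) * ((r + (n - (m + 1) * p)).choose r : ℚ) := by
  have h1 : PowerSeries.mk (fun a => if a ≤ m then (1 : ℚ) else 0) * (1 - X) =
      1 - X ^ (m + 1) := by
    ext a
    rw [mul_sub, mul_one, map_sub, map_sub, coeff_X_pow, coeff_one]
    cases a with
    | zero => simp
    | succ a =>
      rw [coeff_succ_mul_X, coeff_mk, coeff_mk]
      rcases lt_trichotomy a m with h | h | h
      · simp [h.le, h.ne, Nat.succ_le_of_lt h]
      · simp [h]
      · simp [h.not_ge, h.ne', show ¬ a + 1 ≤ m by omega]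
  have h2 : PowerSeries.mk (fun a => if a ≤ m then (1 : ℚ) else 0) ^ (r + 1) =
      (1 - X ^ (m + 1)) ^ (r + 1) * PowerSeries.mk (fun n => ((r + n).choose r : ℚ)) := by
    rw [← h1, mul_pow, mul_assoc, ← invOneSubPow_val_succ_eq_mk_add_choose,
      ← invOneSubPow_inv_eq_one_sub_pow, Units.inv_val, mul_one]
  have h3 : (1 - X ^ (m + 1) : PowerSeries ℚ) ^ (r + 1) =
      ∑ p ∈ Finset.range (r + 2), C ((-1 : ℚ) ^ p * ((r + 1).choose p : ℚ)) * X ^ ((m + 1) * p) := by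
    rw [sub_eq_neg_add, add_pow]
    refine Finset.sum_congr rfl fun p _ => ?_
    rw [neg_pow, one_pow, mul_one, ← pow_mul, map_mul, map_pow, map_neg, map_one, map_natCast]
    ring
  rw [h2, h3, Finset.sum_mul, map_sum]
  have h4 : ∀ p, coeff n (C ((-1 : ℚ) ^ p * ((r + 1).choose p : ℚ)) * X ^ ((m + 1) * p) *
      PowerSeries.mk (fun n => ((r + n).choose r : ℚ))) = if (m + 1) * p ≤ n then
        (-1 : ℚ) ^ p * ((r + 1).choose p : ℚ) * ((r + (n - (m + 1) * p)).choose r : ℚ) else 0 := by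
    intro p
    rw [mul_assoc, coeff_C_mul, coeff_X_pow_mul']
    split_ifs <;> simp
  simp only [h4]
  rw [Finset.sum_filter]
  -- The binomial theorem gives `p ≤ r + 1`, the target `p ≤ n`. Excess terms vanish by the binomial
  -- coefficient or by `(m + 1) p > n`.
  rcases le_total (r + 2) (n + 1) with h | h
  · refine Finset.sum_subset (Finset.range_mono h) fun p _ hp => ?_
    rw [Finset.mem_range, not_lt] at hp
    rw [Nat.choose_eq_zero_of_lt (by omega : r + 1 < p)]
    simp
  · refine (Finset.sum_subset (Finset.range_mono h) fun p _ hp => ?_).symm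
    rw [Finset.mem_range, not_lt] at hp
    exact if_neg (by nlinarith)

/-- With `a = n - (m + 1) p`, both sides equal `(2n + a)! / (p! a! (2n + 1 - p)!)`. -/
theorem choose_mul_choose_div {m n p : ℕ} (hp : (m + 1) * p ≤ n) (hmp : m * p < n) :
    1 / ((n : ℚ) - (m : ℚ) * (p : ℚ)) * ((n - m * p).choose p : ℚ) *
        ((3 * n - m * p - p).choose (n - m * p - 1) : ℚ) =
      ((2 * n + 1).choose p : ℚ) * ((2 * n + (n - (m + 1) * p)).choose (2 * n) : ℚ) /
        (2 * n + 1) := by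
  obtain ⟨q, hq⟩ : ∃ q, m * p = q := ⟨_, rfl⟩
  have hq' : (m : ℚ) * p = q := by exact_mod_cast hq
  have hmp1 : (m + 1) * p = q + p := by rw [add_mul, hq, one_mul]
  rw [hmp1] at hp ⊢
  rw [hq] at hmp ⊢
  obtain ⟨a, rfl⟩ := Nat.exists_eq_add_of_le hp
  have e1 : q + p + a - q = a + p := by omega
  have e2 : q + p + a - (q + p) = a := by omega
  have e3 : 3 * (q + p + a) - q - p = 2 * (q + p + a) + a := by omega
  obtain ⟨b, hb⟩ : ∃ b, a + p = b + 1 := ⟨a + p - 1, by omega⟩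
  have e4 : 2 * (q + p + a) + a = b + (2 * q + p + 2 * a + 1) := by omega
  have e5 : 2 * (q + p + a) + 1 = p + (2 * q + p + 2 * a + 1) := by omega
  rw [hq', e1, e2, e3]
  have h6 : ((q + p + a : ℕ) : ℚ) - q = (b + 1 : ℕ) := by rw [← hb]; push_cast; ring
  have h7 : (2 * ((q + p + a : ℕ) : ℚ) + 1) = ((2 * (q + p + a) + 1 : ℕ) : ℚ) := by push_cast; ring
  generalize 2 * q + p + 2 * a + 1 = M at *
  generalize q + p + a = T at *
  have c1 : ((a + p).choose p : ℚ) =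
      ((b + 1 : ℕ) : ℚ) * b.factorial / (p.factorial * a.factorial) := by
    rw [add_comm a p, Nat.cast_add_choose, add_comm p a, hb, Nat.factorial_succ, Nat.cast_mul]
  have c2 : ((2 * T + a).choose b : ℚ) =
      (2 * T + a).factorial / (b.factorial * M.factorial) := by
    rw [e4, Nat.cast_add_choose]
  have c3 : ((2 * T + 1).choose p : ℚ) =
      ((2 * T + 1 : ℕ) : ℚ) * (2 * T).factorial / (p.factorial * M.factorial) := by
    rw [← Nat.cast_mul, ← Nat.factorial_succ, e5, Nat.cast_add_choose]
  rw [h6, h7, c1, show a + p - 1 = b by omega, c2, c3, Nat.cast_add_choose]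
  have f : ∀ k : ℕ, (k.factorial : ℚ) ≠ 0 := fun k => by positivity
  have f1 := f p
  have f2 := f a
  have f3 := f b
  have f4 := f M
  have f5 := f (2 * T)
  have f6 : ((b + 1 : ℕ) : ℚ) ≠ 0 := by positivity
  have f7 : ((2 * T + 1 : ℕ) : ℚ) ≠ 0 := by positivity
  field_simp

/-- The explicit count, from the coefficient extraction. -/
theorem eq_sum_of_mul_eq_coeff {m n : ℕ} (hn : 1 ≤ n) (hm : 1 ≤ m) {x : ℚ}
    (hx : (2 * n + 1 : ℚ) * x =
      coeff n (PowerSeries.mk (fun a => if a ≤ m then (1 : ℚ) else 0) ^ (2 * n + 1))) :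
    x = ∑ p ∈ (Finset.range n).filter (fun p => m * p < n),
      (-1 : ℚ) ^ p / ((n : ℚ) - (m : ℚ) * (p : ℚ)) * ((n - m * p).choose p : ℚ) *
        ((3 * n - m * p - p).choose (n - m * p - 1) : ℚ) := by
  have h0 : (2 * n + 1 : ℚ) ≠ 0 := by positivity
  rw [coeff_mk_le_pow] at hx
  rw [eq_div_of_mul_eq h0 ((mul_comm _ _).trans hx), Finset.sum_div]
  -- Here `1 ≤ n` keeps `p = 0`, and `1 ≤ m` gives `p ≤ m * p < n`.
  have hsub : (Finset.range (n + 1)).filter (fun p => (m + 1) * p ≤ n) ⊆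
      (Finset.range n).filter (fun p => m * p < n) := by
    intro p hp
    simp only [Finset.mem_filter, Finset.mem_range] at hp ⊢
    rcases Nat.eq_zero_or_pos p with rfl | hp0
    · simp only [mul_zero]; omega
    · have : p ≤ m * p := Nat.le_mul_of_pos_left p hm
      have h2 := hp.2
      rw [add_mul, one_mul] at h2
      omega
  rw [← Finset.sum_subset hsub]
  · refine Finset.sum_congr rfl fun p hp => ?_
    have hp2 := hsub hp
    simp only [Finset.mem_filter, Finset.mem_range] at hp hp2
    have key := choose_mul_choose_div hp.2 hp2.2
    calc _ = (-1 : ℚ) ^ p * (((2 * n + 1).choose p : ℚ) *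
          ((2 * n + (n - (m + 1) * p)).choose (2 * n) : ℚ) / (2 * n + 1)) := by ring
      _ = _ := by rw [← key]; ring
  -- The additional terms have `n - m * p < p`, so their first binomial coefficient is zero.
  · intro p hp hp'
    simp only [Finset.mem_filter, Finset.mem_range, not_and, not_le, add_mul, one_mul] at hp hp'
    have := hp' (by omega)
    rw [Nat.choose_eq_zero_of_lt (show n - m * p < p by omega)]
    simp

end Count

theorem theorem2 (n m : ℕ) (hm : 1 ≤ m)
    (v : Fin (2 * n) → EuclideanSpace ℝ (Fin 2)) (hv : IsConvexPolygon v) :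
    Nonempty (colouredDyck (boundedDyck m) n ≃ evenHullPartitions m v) ∧
    (colouredDyck (boundedDyck m) n).Finite ∧ (evenHullPartitions m v).Finite ∧
    (1 ≤ n →
      ((colouredDyck (boundedDyck m) n).ncard : ℚ) =
        ∑ p ∈ (Finset.range n).filter (fun p => m * p < n),
          (-1 : ℚ) ^ p / ((n : ℚ) - (m : ℚ) * (p : ℚ)) * ((n - m * p).choose p : ℚ) *
            ((3 * n - m * p - p).choose (n - m * p - 1) : ℚ) ∧
      ((evenHullPartitions m v).ncard : ℚ) =
        ∑ p ∈ (Finset.range n).filter (fun p => m * p < n),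
          (-1 : ℚ) ^ p / ((n : ℚ) - (m : ℚ) * (p : ℚ)) * ((n - m * p).choose p : ℚ) *
            ((3 * n - m * p - p).choose (n - m * p - 1) : ℚ)) := by
  have hD := ncard_colouredDyck_boundedDyck m n
  have hE := ncard_evenHullPartitions m hv
  have hDf := finite_colouredDyck (finite_boundedDyck m) n
  have hEf : (evenHullPartitions m v).Finite := Set.toFinite _
  have hcard : (colouredDyck (boundedDyck m) n).ncard = (evenHullPartitions m v).ncard := by
    have h0 : (2 * n + 1 : ℚ) ≠ 0 := by positivity
    exact_mod_cast mul_left_cancel₀ h0 (hD.trans hE.symm)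
  refine ⟨?_, hDf, hEf, fun hn => ⟨eq_sum_of_mul_eq_coeff hn hm hD, eq_sum_of_mul_eq_coeff hn hm hE⟩⟩
  have := hDf.to_subtype
  have := hEf.to_subtype
  exact Finite.card_eq.1 hcard
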